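/- A job $j$ has a release time $r_j$, a deadline $d_j>r_j$ and a processing time (size) $p_j>0$; its relative laxity is $(d_j-r_j-p_j)/(d_j-r_j)$. Jobs are processed preemptively, with free migration, on identical unit-speed machines: at each time a machine processes at most one job and a job is processed on at most one machine. A schedule is feasible if every job $j$ receives $p_j$ units of processing during $[r_j,d_j)$. For a finite set of jobs, let $m^*$ be the least number of machines on which a feasible (offline) schedule exists. Shortest Job First (SJF) on $m$ machines processes, at each time $t$, $m$ jobs of smallest original size $p_j$ among those that are released and not yet completed at time $t$ (all of them if there are fewer than $m$), with ties broken arbitrarily. There is an absolute constant $c>0$ such that the following holds for all real $0<\lambda_1\le\lambda_2\le 1/2$ and every finite set of jobs all of whose relative laxities lie in $[\lambda_1,\lambda_2]$. For every integer $m\ge 0$ with $$m\;\ge\; c\cdot\max\Bigl\{1,\ \log_{1/\lambda_2}\frac{5\lambda_2}{\lambda_1}\Bigr\}\cdot m^*,$$ an SJF schedule of the jobs on $m$ machines exists, and every such schedule is feasible. That is, SJF feasibly schedules the jobs on $O\bigl(\max\{1,\log_{1/\lambda_2}(5\lambda_2/\lambda_1)\}\cdot m^*\bigr)$ machines. -/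

import Mathlib

open MeasureTheory

namespace Sched

/-- A job, with its release time, its deadline and its processing time. -/
structure Job where
  release : ℝ
  deadline : ℝ
  size : ℝ
  release_lt_deadline : release < deadline
  size_pos : 0 < size

/-- The laxity `d - r - p`. -/
def Job.laxity (j : Job) : ℝ := j.deadline - j.release - j.size

/-- The laxity divided by the length `d - r` of the lifespan. -/
noncomputable def Job.relLaxity (j : Job) : ℝ := j.laxity / (j.deadline - j.release)

/-- A preemptive migratory schedule on `m` identical unit-speed machines: at each time a set of at
most `m` distinct jobs is processed (one job per machine; a job runs on at most one machine at a
time, and since migration is free the names of the machines play no role). -/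
structure Schedule (ι : Type*) (m : ℕ) where
  running : ℝ → Finset ι
  card_le : ∀ t, (running t).card ≤ m
  measurable : ∀ j, MeasurableSet {t | j ∈ running t}

section
variable {ι : Type*} {m : ℕ}

/-- The amount of work done on job `j` from its release up to time `t`. -/
noncomputable def processed (J : ι → Job) (S : Schedule ι m) (j : ι) (t : ℝ) : ℝ :=
  volume.real ({s | j ∈ S.running s} ∩ Set.Ico (J j).release t)

/-- Every job receives its full processing time between its release and its deadline. -/
def Feasible (J : ι → Job) (S : Schedule ι m) : Prop :=
  ∀ j, (J j).size ≤ processed J S j (J j).deadline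

/-- Job `j` is released and not yet completed at time `t`. -/
def Alive (J : ι → Job) (S : Schedule ι m) (j : ι) (t : ℝ) : Prop :=
  (J j).release ≤ t ∧ processed J S j t < (J j).size

/-- `S` is a Shortest Job First schedule: at each time it processes only alive jobs, and if some
alive job is left waiting, then all `m` machines are busy with jobs whose original sizes are at
most the size of the waiting job (ties may be broken in any way). -/
def IsSJF (J : ι → Job) (S : Schedule ι m) : Prop :=
  ∀ t, (∀ j ∈ S.running t, Alive J S j t) ∧
    ∀ j, Alive J S j t → j ∉ S.running t →
      (S.running t).card = m ∧ ∀ i ∈ S.running t, (J i).size ≤ (J j).size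

end

/-- The least number of machines on which some (offline) schedule of the jobs is feasible. -/
noncomputable def minMachines {ι : Type*} (J : ι → Job) : ℕ :=
  sInf {m : ℕ | ∃ S : Schedule ι m, Feasible J S}

end Sched

/-!
Write `[r, d)` for the lifespan of a job, `ℓ` for its length, `M` for the least number of machines
and `λ = lam₂`. A job fails under SJF only if it waits for longer than its laxity, and while it
waits, `m` jobs of no larger size run. For a failing job with the earliest deadline all of these are
still in their own lifespans (`IsSJF.feasible`), whose lengths are at most `2 * ℓ` because sizes and
lengths agree up to a factor `2`. It therefore suffices to bound the measure of the points of
`[r, d)` that lie in at least `m` lifespans of length at most `2 * ℓ` by the laxity, which is at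
least `lam₁ * ℓ`.

An optimal schedule processes each job during all but a fraction `λ` of its lifespan, with at most
`M` jobs at a time (`DensePacking`). For such a packing the depth of the lifespans has exponential
tails with base `λ`, a John–Nirenberg inequality (`DensePacking.measureReal_deepPoints_le`): inside
a window `W`, the points lying in `1535 * k * M` lifespans of length `O(|W|)` have measure at most
`λ ^ k * |W|`. The case `k = 1` is Chebyshev's inequality: only `M` jobs run at a time, so that most
of the lifespans through a deep point contribute to the idle parts, of total measure
`O(λ * M * |W|)`. For the induction, each deep point `t` has a pivot, a lifespan `I ∋ t` with
`1535 * M` longer and `1535 * k * M` shorter ones through `t`. Of the longer ones only `4 * M` can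
have length less than `|I| / (4 * λ)` (`DensePacking.card_le_of_comparable`); the others cover all
of `I` once they are enlarged by `4 * λ` times their length on both sides, which the Chebyshev
argument tolerates. A Vitali selection of disjoint pivots thus has total length at most
`λ * |W| / 5`, and the induction hypothesis applies to the shorter lifespans in the pivots enlarged
fivefold.

With `k = ⌈log_{1/λ} (λ / lam₁)⌉ + 1` one has `λ ^ k ≤ lam₁`, which yields the number of machines.

An SJF schedule exists because jobs can be scheduled greedily in order of increasing size, each on
the machines that the earlier ones leave idle (`exists_isSJF_on`).
-/

namespace Sched

/-! ### Double counting of measures -/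

section Counting
variable {ι α : Type*} [MeasurableSpace α]

lemma lintegral_sum_indicator (μ : Measure α) (s : Finset ι) (X : ι → Set α)
    (hX : ∀ i ∈ s, MeasurableSet (X i)) :
    ∫⁻ t, ∑ i ∈ s, (X i).indicator (1 : α → ENNReal) t ∂μ = ∑ i ∈ s, μ (X i) := by
  rw [lintegral_finsetSum' s
    (fun i hi => (measurable_one.indicator (hX i hi)).aemeasurable)]
  exact Finset.sum_congr rfl fun i hi => lintegral_indicator_one (hX i hi)

lemma nat_mul_measure_le_sum (μ : Measure α) (s : Finset ι) (X : ι → Set α)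
    (hX : ∀ i ∈ s, MeasurableSet (X i)) (n : ℕ) (A : Set α)
    (hA : ∀ t ∈ A, ∃ T ⊆ s, n ≤ T.card ∧ ∀ i ∈ T, t ∈ X i) :
    (n : ENNReal) * μ A ≤ ∑ i ∈ s, μ (X i) := by
  rw [← lintegral_sum_indicator μ s X hX]
  have hf : Measurable fun t => ∑ i ∈ s, (X i).indicator (1 : α → ENNReal) t :=
    Finset.measurable_fun_sum s fun i hi => measurable_one.indicator (hX i hi)
  refine le_trans ?_ (mul_meas_ge_le_lintegral hf (n : ENNReal))
  gcongr
  intro t ht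
  obtain ⟨T, hTs, hn, hT⟩ := hA t ht
  calc (n : ENNReal) ≤ (T.card : ENNReal) := by exact_mod_cast hn
    _ = ∑ i ∈ T, (X i).indicator (1 : α → ENNReal) t := by
        rw [Finset.sum_congr rfl fun i hi => Set.indicator_of_mem (hT i hi) _]; simp
    _ ≤ _ := Finset.sum_le_sum_of_subset hTs

lemma sum_measure_le_nat_mul (μ : Measure α) (s : Finset ι) (X : ι → Set α)
    (hX : ∀ i ∈ s, MeasurableSet (X i)) (M : ℕ) (V : Set α) (hV : MeasurableSet V)
    (hXV : ∀ i ∈ s, X i ⊆ V)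
    (hM : ∀ t, ∀ T ⊆ s, (∀ i ∈ T, t ∈ X i) → T.card ≤ M) :
    ∑ i ∈ s, μ (X i) ≤ (M : ENNReal) * μ V := by
  classical
  rw [← lintegral_sum_indicator μ s X hX, ← lintegral_indicator_const hV]
  refine lintegral_mono fun t => ?_
  have h1 : ∑ i ∈ s, (X i).indicator (1 : α → ENNReal) t
      = ((s.filter fun i => t ∈ X i).card : ENNReal) := by
    simp [Set.indicator_apply, Finset.sum_boole]
  rw [h1]
  by_cases ht : t ∈ V
  · rw [Set.indicator_of_mem ht]
    exact Nat.cast_le.2 <| hM t _ (Finset.filter_subset _ _) fun i hi => (Finset.mem_filter.1 hi).2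
  · have h0 : s.filter (fun i => t ∈ X i) = ∅ :=
      Finset.filter_eq_empty_iff.2 fun i hi h => ht (hXV i hi h)
    simp [h0]

lemma nat_mul_measureReal_le_sum (μ : Measure α) (s : Finset ι) (X : ι → Set α)
    (hX : ∀ i ∈ s, MeasurableSet (X i)) (hfin : ∀ i ∈ s, μ (X i) ≠ ⊤) (n : ℕ) (A : Set α)
    (hA : ∀ t ∈ A, ∃ T ⊆ s, n ≤ T.card ∧ ∀ i ∈ T, t ∈ X i) :
    (n : ℝ) * μ.real A ≤ ∑ i ∈ s, μ.real (X i) := by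
  have h := ENNReal.toReal_mono (ENNReal.sum_ne_top.2 hfin)
    (nat_mul_measure_le_sum μ s X hX n A hA)
  rwa [ENNReal.toReal_mul, ENNReal.toReal_natCast, ENNReal.toReal_sum hfin] at h

lemma sum_measureReal_le_nat_mul (μ : Measure α) (s : Finset ι) (X : ι → Set α)
    (hX : ∀ i ∈ s, MeasurableSet (X i)) (M : ℕ) (V : Set α) (hV : MeasurableSet V)
    (hVfin : μ V ≠ ⊤) (hXV : ∀ i ∈ s, X i ⊆ V)
    (hM : ∀ t, ∀ T ⊆ s, (∀ i ∈ T, t ∈ X i) → T.card ≤ M) :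
    ∑ i ∈ s, μ.real (X i) ≤ (M : ℝ) * μ.real V := by
  have h := ENNReal.toReal_mono (ENNReal.mul_ne_top (ENNReal.natCast_ne_top M) hVfin)
    (sum_measure_le_nat_mul μ s X hX M V hV hXV hM)
  rwa [ENNReal.toReal_mul, ENNReal.toReal_natCast, ENNReal.toReal_sum
    (fun i hi => measure_ne_top_of_subset (hXV i hi) hVfin)] at h

end Counting

/-- A finite set of at least `(k + 1) * r` elements, ordered by a real key, has an element with at
least `r` elements weakly above it and at least `k * r` elements weakly below it. -/
lemma exists_pivot {ι : Type*} (f : ι → ℝ) (T : Finset ι) (k r : ℕ) (hr : 0 < r)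
    (hT : (k + 1) * r ≤ T.card) :
    ∃ j ∈ T, r ≤ (T.filter fun i => f j ≤ f i).card ∧
      k * r ≤ (T.filter fun i => f i ≤ f j).card := by
  classical
  have hTne : T.Nonempty := by
    rw [← Finset.card_pos]; nlinarith
  obtain ⟨i₀, hi₀, hmin⟩ := T.exists_min_image f hTne
  obtain ⟨j, hj, hmax⟩ :=
    (T.filter fun j => r ≤ (T.filter fun i => f j ≤ f i).card).exists_max_image f
      ⟨i₀, by
        rw [Finset.mem_filter, Finset.filter_true_of_mem hmin]
        exact ⟨hi₀, by nlinarith⟩⟩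
  rw [Finset.mem_filter] at hj
  refine ⟨j, hj.1, hj.2, ?_⟩
  -- By maximality of `f j`, fewer than `r` elements lie strictly above `j`.
  have habove : (T.filter fun i => ¬ f i ≤ f j).card < r := by
    by_contra hlt
    have hge := not_lt.1 hlt
    obtain ⟨l, hl, hlmin⟩ := (T.filter fun i => ¬ f i ≤ f j).exists_min_image f
      (Finset.card_pos.1 (hr.trans_le hge))
    rw [Finset.mem_filter, not_le] at hl
    refine (hmax l (Finset.mem_filter.2 ⟨hl.1, hge.trans (Finset.card_le_card ?_)⟩)).not_gt hl.2
    intro i hi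
    exact Finset.mem_filter.2 ⟨(Finset.mem_filter.1 hi).1, hlmin i hi⟩
  have hsum := Finset.card_filter_add_card_filter_not (s := T) (fun i => f i ≤ f j)
  nlinarith

/-! ### Depth of a family of densely packed intervals -/

/-- Intervals `[a i, b i)`, each with a measurable subset `E i` filling all but a fraction `lam` of
it, such it, such that no point lies in more than `M` of the sets `E i`. The parameters are restricted to
`0 < lam ≤ 1 / 2` and `0 < M`. -/
structure DensePacking {ι : Type*} (a b : ι → ℝ) (E : ι → Set ℝ) (lam : ℝ) (M : ℕ) : Prop where
  lt : ∀ i, a i < b i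
  measurable : ∀ i, MeasurableSet (E i)
  subset : ∀ i, E i ⊆ Set.Ico (a i) (b i)
  dense : ∀ i, (1 - lam) * (b i - a i) ≤ volume.real (E i)
  card_le : ∀ t, ∀ T : Finset ι, (∀ i ∈ T, t ∈ E i) → T.card ≤ M
  lam_pos : 0 < lam
  lam_le : lam ≤ 1 / 2
  pos : 0 < M

/-- The points lying in at least `n` of the intervals `[a i, b i)` of length at most `s`. -/
def deepPoints {ι : Type*} (a b : ι → ℝ) (s : ℝ) (n : ℕ) : Set ℝ :=
  {t | ∃ T : Finset ι, n ≤ T.card ∧ ∀ i ∈ T, t ∈ Set.Ico (a i) (b i) ∧ b i - a i ≤ s}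

/-- The interval `[a i, b i)` enlarged on both sides by `4 * lam` times its length. -/
def enlarged {ι : Type*} (a b : ι → ℝ) (lam : ℝ) (i : ι) : Set ℝ :=
  Set.Ico (a i - 4 * lam * (b i - a i)) (b i + 4 * lam * (b i - a i))

namespace DensePacking
variable {ι : Type*} {a b : ι → ℝ} {E : ι → Set ℝ} {lam : ℝ} {M : ℕ}

/-- Intervals through a common point whose lengths differ by a factor less than `1 / (4 * lam)` are
at most `4 * M` in number: each of them occupies a quarter of a common window. -/
lemma card_le_of_comparable (h : DensePacking a b E lam M) {t L : ℝ} (hL : 0 < L) (T : Finset ι)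
    (hT : ∀ i ∈ T, t ∈ Set.Ico (a i) (b i) ∧ L ≤ b i - a i ∧ 4 * lam * (b i - a i) < L) :
    T.card ≤ 4 * M := by
  set V := Set.Ico (t - L / 2) (t + L / 2) with hV
  have hup : ∑ i ∈ T, volume.real (E i ∩ V) ≤ M * volume.real V :=
    sum_measureReal_le_nat_mul volume T (fun i => E i ∩ V)
      (fun i _ => (h.measurable i).inter measurableSet_Ico) M V measurableSet_Ico
      (by simp [hV]) (fun i _ => Set.inter_subset_right)
      (fun t' T' _ hT' => h.card_le t' T' fun i hi => (hT' i hi).1)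
  have hlow : ∀ i ∈ T, L / 4 ≤ volume.real (E i ∩ V) := by
    intro i hi
    obtain ⟨⟨hat, htb⟩, hLi, hi4⟩ := hT i hi
    have hIV : L / 2 ≤ volume.real (Set.Ico (a i) (b i) ∩ V) := by
      rw [hV, Set.Ico_inter_Ico, Real.volume_real_Ico]
      refine le_max_of_le_left (le_sub_iff_add_le'.2 (le_min ?_ ?_))
      · exact le_sub_iff_add_le.1 (max_le (by linarith) (by linarith))
      · exact le_sub_iff_add_le.1 (max_le (by linarith) (by linarith))
    have hcov : volume.real (Set.Ico (a i) (b i) ∩ V)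
        ≤ volume.real (E i ∩ V) + volume.real (Set.Ico (a i) (b i) \ E i) := by
      refine (measureReal_mono ?_ ?_).trans (measureReal_union_le _ _)
      · rintro x ⟨hx, hxV⟩
        by_cases hxE : x ∈ E i
        · exact Or.inl ⟨hxE, hxV⟩
        · exact Or.inr ⟨hx, hxE⟩
      · exact (measure_union_lt_top (measure_lt_top_of_subset Set.inter_subset_right (by simp [hV]))
          (measure_lt_top_of_subset Set.sdiff_subset (by simp))).ne
    have hdiff : volume.real (Set.Ico (a i) (b i) \ E i) = (b i - a i) - volume.real (E i) := by
      rw [measureReal_sdiff (h.subset i) (h.measurable i) (by simp),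
        Real.volume_real_Ico_of_le (h.lt i).le]
    have := h.dense i
    linarith
  have hc : (T.card : ℝ) * (L / 4) ≤ M * L := by
    calc (T.card : ℝ) * (L / 4) = ∑ i ∈ T, L / 4 := by simp
      _ ≤ ∑ i ∈ T, volume.real (E i ∩ V) := Finset.sum_le_sum hlow
      _ ≤ M * volume.real V := hup
      _ = M * L := by rw [hV, Real.volume_real_Ico_of_le (by linarith)]; ring
  have : (T.card : ℝ) ≤ 4 * M := by
    have : (T.card : ℝ) * L ≤ (4 * M) * L := by linarith
    exact le_of_mul_le_mul_right this hL
  exact_mod_cast this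

/-- Chebyshev's inequality for the depth of the enlarged intervals. At most `M` of the sets `E i`
contain a given point, so at a point of depth `1531 * M` some `1530 * M` of the small remainders
`enlarged a b lam i \ E i` meet. -/
lemma measureReal_enlarged_deep_le [Finite ι] (h : DensePacking a b E lam M) {u v s : ℝ}
    (huv : u < v) (hs0 : 0 ≤ s) (hs : s ≤ 2 * (v - u)) (A : Set ℝ)
    (hA : ∀ t ∈ A, t ∈ Set.Ico (u - s) (v + s) ∧ ∃ T : Finset ι, 1531 * M ≤ T.card ∧
      ∀ i ∈ T, t ∈ enlarged a b lam i ∧ b i - a i ≤ s) :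
    5 * volume.real A ≤ lam * (v - u) := by
  classical
  have := Fintype.ofFinite ι
  have hlam := h.lam_pos
  have hlam2 := h.lam_le
  -- The intervals that matter all lie in `[u - 4 * s, v + 4 * s)`.
  set V := Set.Ico (u - 4 * s) (v + 4 * s) with hV
  set F : Finset ι := Finset.univ.filter fun i => Set.Ico (a i) (b i) ⊆ V with hF
  have hcheb : ((1530 * M : ℕ) : ℝ) * volume.real A
      ≤ ∑ i ∈ F, volume.real (enlarged a b lam i \ E i) := by
    refine nat_mul_measureReal_le_sum volume F (fun i => enlarged a b lam i \ E i)
      (fun i _ => measurableSet_Ico.diff (h.measurable i))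
      (fun i _ => measure_ne_top_of_subset Set.sdiff_subset (by simp [enlarged])) _ _ ?_
    intro t ht
    obtain ⟨htW, T, hTc, hT⟩ := hA t ht
    refine ⟨T.filter fun i => t ∉ E i, ?_, ?_, ?_⟩
    · intro i hi
      obtain ⟨⟨h1, h2⟩, h3⟩ := hT i (Finset.mem_filter.1 hi).1
      have hl := h.lt i
      have h4 : 4 * lam * (b i - a i) ≤ 2 * (b i - a i) := by nlinarith
      rw [hF, Finset.mem_filter]
      refine ⟨Finset.mem_univ i, Set.Ico_subset_Ico ?_ ?_⟩
      · linarith [htW.1, htW.2]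
      · linarith [htW.1, htW.2]
    · have h1 := Finset.card_filter_add_card_filter_not (s := T) (fun i => t ∈ E i)
      have h2 := h.card_le t (T.filter fun i => t ∈ E i) fun i hi => (Finset.mem_filter.1 hi).2
      omega
    · intro i hi
      rw [Finset.mem_filter] at hi
      exact ⟨(hT i hi.1).1, hi.2⟩
  have hpack : ∑ i ∈ F, volume.real (E i) ≤ M * volume.real V :=
    sum_measureReal_le_nat_mul volume F E (fun i _ => h.measurable i) M V measurableSet_Ico
      (by simp [hV]) (fun i hi => (h.subset i).trans (Finset.mem_filter.1 hi).2)
      (fun t T _ hT => h.card_le t T hT)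
  have hrem : ∀ i ∈ F, volume.real (enlarged a b lam i \ E i) ≤ 18 * lam * volume.real (E i) := by
    intro i _
    have hl := h.lt i
    have h0 : 0 ≤ 4 * lam * (b i - a i) := by
      have : 0 ≤ b i - a i := by linarith
      positivity
    have hsub : E i ⊆ enlarged a b lam i :=
      (h.subset i).trans (Set.Ico_subset_Ico (by linarith) (by linarith))
    rw [measureReal_sdiff hsub (h.measurable i) (by simp [enlarged]), enlarged,
      Real.volume_real_Ico_of_le (by linarith)]
    have hd := h.dense i
    have : b i - a i ≤ 2 * volume.real (E i) := by nlinarith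
    nlinarith
  have hVle : volume.real V ≤ 17 * (v - u) := by
    rw [hV, Real.volume_real_Ico_of_le (by linarith)]; linarith
  have hM : (0 : ℝ) < M := by exact_mod_cast h.pos
  have hfin : (1530 * M : ℝ) * volume.real A ≤ 18 * lam * (M * (17 * (v - u))) := by
    calc (1530 * M : ℝ) * volume.real A ≤ ∑ i ∈ F, volume.real (enlarged a b lam i \ E i) := by
          exact_mod_cast hcheb
      _ ≤ ∑ i ∈ F, 18 * lam * volume.real (E i) := Finset.sum_le_sum hrem
      _ = 18 * lam * ∑ i ∈ F, volume.real (E i) := by rw [Finset.mul_sum]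
      _ ≤ 18 * lam * (M * (17 * (v - u))) := by
          gcongr
          exact hpack.trans (by gcongr)
  have : (306 * M) * (5 * volume.real A) ≤ (306 * M) * (lam * (v - u)) := by linarith
  exact le_of_mul_le_mul_left this (by positivity)

/-- If some point of `[a j, b j)` lies in `1535 * M` intervals at least as long as it, then every
point of `[a j, b j)` lies in `1531 * M` enlarged intervals: the intervals that are not much longer
are few, and the much longer ones, once enlarged, swallow `[a j, b j)`. -/
lemma exists_enlarged_of_deep (h : DensePacking a b E lam M) {s t t' : ℝ} {j : ι}
    (ht : t ∈ Set.Ico (a j) (b j)) (ht' : t' ∈ Set.Ico (a j) (b j)) (T : Finset ι)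
    (hTc : 1535 * M ≤ T.card)
    (hT : ∀ i ∈ T, t ∈ Set.Ico (a i) (b i) ∧ b i - a i ≤ s ∧ b j - a j ≤ b i - a i) :
    ∃ T' : Finset ι, 1531 * M ≤ T'.card ∧
      ∀ i ∈ T', t' ∈ enlarged a b lam i ∧ b i - a i ≤ s := by
  classical
  have hlj := h.lt j
  refine ⟨T.filter fun i => ¬ 4 * lam * (b i - a i) < b j - a j, ?_, ?_⟩
  · have h1 := Finset.card_filter_add_card_filter_not (s := T)
      (fun i => 4 * lam * (b i - a i) < b j - a j)
    have h2 := h.card_le_of_comparable (t := t) (L := b j - a j) (by linarith)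
      (T.filter fun i => 4 * lam * (b i - a i) < b j - a j) (by
        intro i hi
        rw [Finset.mem_filter] at hi
        exact ⟨(hT i hi.1).1, (hT i hi.1).2.2, hi.2⟩)
    omega
  · intro i hi
    rw [Finset.mem_filter, not_lt] at hi
    obtain ⟨hti, his, -⟩ := hT i hi.1
    refine ⟨⟨?_, ?_⟩, his⟩
    · linarith [hti.1, hti.2, ht.1, ht.2, ht'.1, ht'.2, hi.2]
    · linarith [hti.1, hti.2, ht.1, ht.2, ht'.1, ht'.2, hi.2]

/-- A John–Nirenberg inequality: in a window, the points lying in at least `k * (1535 * M)`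
intervals of length at most twice that of the window have measure at most `lam ^ k` times the
length of the window. Of the `1535 * M` intervals per factor `lam`, `4 * M` are lost in
`exists_enlarged_of_deep` and `1531 * M` are needed for `measureReal_enlarged_deep_le`. -/
lemma measureReal_deepPoints_le [Finite ι] (h : DensePacking a b E lam M) (k : ℕ) :
    ∀ {u v s : ℝ}, u < v → s ≤ 2 * (v - u) →
      volume.real (Set.Ico u v ∩ deepPoints a b s (k * (1535 * M))) ≤ lam ^ k * (v - u) := by
  have hlam := h.lam_pos
  have hM := h.pos
  induction k with
  | zero =>
    intro u v s huv _
    rw [pow_zero, one_mul, ← Real.volume_real_Ico_of_le huv.le]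
    exact measureReal_mono Set.inter_subset_left (by simp)
  | succ k ih =>
    intro u v s huv hs
    -- The intervals that occur as pivots of deep points of the window.
    set P : Set ι := {j | b j - a j ≤ s ∧ ∃ t ∈ Set.Ico u v ∩ Set.Ico (a j) (b j),
      ∃ T : Finset ι, 1535 * M ≤ T.card ∧
        ∀ i ∈ T, t ∈ Set.Ico (a i) (b i) ∧ b i - a i ≤ s ∧ b j - a j ≤ b i - a i} with hP
    obtain ⟨w, hwP, hwdisj, hwcov⟩ := Vitali.exists_disjoint_subfamily_covering_enlargement
      (fun j => Set.Ico (a j) (b j)) P (fun j => b j - a j) 2 (by norm_num)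
      (fun j _ => by linarith [h.lt j]) s (fun j hj => hj.1)
      (fun j _ => Set.nonempty_Ico.2 (h.lt j))
    set w' : Finset ι := w.toFinite.toFinset with hw'
    have hmem : ∀ j, j ∈ w' ↔ j ∈ w := fun j => by simp [hw']
    have hcover : Set.Ico u v ∩ deepPoints a b s ((k + 1) * (1535 * M)) ⊆
        ⋃ j ∈ w', (Set.Ico (a j - 2 * (b j - a j)) (b j + 2 * (b j - a j)) ∩
          deepPoints a b (2 * (b j - a j)) (k * (1535 * M))) := by
      rintro t ⟨htW, T, hTc, hT⟩
      obtain ⟨i, hiT, hi1, hi2⟩ := exists_pivot (fun i => b i - a i) T k (1535 * M) (by omega) hTc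
      have hiP : i ∈ P := by
        refine ⟨(hT i hiT).2, t, ⟨htW, (hT i hiT).1⟩, _, hi1, ?_⟩
        intro l hl
        rw [Finset.mem_filter] at hl
        exact ⟨(hT l hl.1).1, (hT l hl.1).2, hl.2⟩
      obtain ⟨j, hjw, ⟨x, hxi, hxj⟩, hij⟩ := hwcov i hiP
      refine Set.mem_biUnion (x := j) ((hmem j).2 hjw) ⟨?_, _, hi2, ?_⟩
      · have hti := (hT i hiT).1
        constructor
        · linarith [hti.1, hti.2, hxi.1, hxi.2, hxj.1, hxj.2]
        · linarith [hti.1, hti.2, hxi.1, hxi.2, hxj.1, hxj.2]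
      · intro l hl
        rw [Finset.mem_filter] at hl
        exact ⟨(hT l hl.1).1, hl.2.trans hij⟩
    rcases w'.eq_empty_or_nonempty with hw0 | ⟨j₀, hj₀⟩
    · have : Set.Ico u v ∩ deepPoints a b s ((k + 1) * (1535 * M)) = ∅ := by
        simpa [hw0] using hcover
      rw [this, measureReal_empty]
      have : 0 < v - u := by linarith
      positivity
    have hs0 : 0 ≤ s := by
      have := (hwP ((hmem j₀).1 hj₀)).1
      linarith [h.lt j₀]
    -- The selected intervals are disjoint and consist of points of large enlarged depth.
    have hsel : 5 * ∑ j ∈ w', (b j - a j) ≤ lam * (v - u) := by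
      have hU : ∑ j ∈ w', (b j - a j) = volume.real (⋃ j ∈ w', Set.Ico (a j) (b j)) := by
        rw [measureReal_biUnion_finset (h := fun _ _ => by simp)]
        · exact Finset.sum_congr rfl fun j _ => (Real.volume_real_Ico_of_le (h.lt j).le).symm
        · intro x hx y hy hxy
          exact hwdisj ((hmem x).1 hx) ((hmem y).1 hy) hxy
        · exact fun _ _ => measurableSet_Ico
      rw [hU]
      refine h.measureReal_enlarged_deep_le huv hs0 hs _ ?_
      intro t' ht'
      obtain ⟨j, hj, ht'j⟩ := Set.mem_iUnion₂.1 ht'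
      obtain ⟨hjs, t, ⟨htW, htj⟩, T, hTc, hT⟩ := hwP ((hmem j).1 hj)
      refine ⟨⟨?_, ?_⟩, h.exists_enlarged_of_deep htj ht'j T hTc hT⟩
      · linarith [ht'j.1, ht'j.2, htj.1, htj.2, htW.1, htW.2]
      · linarith [ht'j.1, ht'j.2, htj.1, htj.2, htW.1, htW.2]
    calc volume.real (Set.Ico u v ∩ deepPoints a b s ((k + 1) * (1535 * M)))
        ≤ volume.real (⋃ j ∈ w', (Set.Ico (a j - 2 * (b j - a j)) (b j + 2 * (b j - a j)) ∩
          deepPoints a b (2 * (b j - a j)) (k * (1535 * M)))) := by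
          refine measureReal_mono hcover (ne_of_lt ?_)
          exact (measure_biUnion_lt_top w'.finite_toSet fun j _ =>
            measure_lt_top_of_subset Set.inter_subset_left (by simp))
      _ ≤ ∑ j ∈ w', volume.real (Set.Ico (a j - 2 * (b j - a j)) (b j + 2 * (b j - a j)) ∩
          deepPoints a b (2 * (b j - a j)) (k * (1535 * M))) := measureReal_biUnion_finset_le _ _
      _ ≤ ∑ j ∈ w', lam ^ k * (5 * (b j - a j)) := by
          refine Finset.sum_le_sum fun j _ => ?_
          have hl := h.lt j
          refine (ih (by linarith) (by linarith)).trans (le_of_eq ?_)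
          ring
      _ = lam ^ k * (5 * ∑ j ∈ w', (b j - a j)) := by
          rw [Finset.mul_sum, Finset.mul_sum]
      _ ≤ lam ^ k * (lam * (v - u)) := by gcongr
      _ = lam ^ (k + 1) * (v - u) := by ring

end DensePacking

/-! ### Shortest Job First -/

section
variable {ι : Type*} {m : ℕ}

lemma processed_mono (J : ι → Job) (S : Schedule ι m) (j : ι) : Monotone (processed J S j) := by
  intro t t' htt'
  exact measureReal_mono (Set.inter_subset_inter_right _ (Set.Ico_subset_Ico_right htt'))
    (measure_ne_top_of_subset Set.inter_subset_right (by simp))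

lemma continuous_measureReal_inter_Ico (B : Set ℝ) (r : ℝ) :
    Continuous fun t => volume.real (B ∩ Set.Ico r t) := by
  refine (LipschitzWith.of_le_add fun x y => ?_).continuous
  have hsub : B ∩ Set.Ico r x ⊆ (B ∩ Set.Ico r y) ∪ Set.Ico y x := by
    rintro z ⟨hzB, hrz, hzx⟩
    rcases lt_or_ge z y with hzy | hzy
    · exact Or.inl ⟨hzB, hrz, hzy⟩
    · exact Or.inr ⟨hzy, hzx⟩
  have hfin : volume ((B ∩ Set.Ico r y) ∪ Set.Ico y x) ≠ ⊤ :=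
    (measure_union_lt_top (measure_lt_top_of_subset Set.inter_subset_right (by simp))
      (by simp)).ne
  refine ((measureReal_mono hsub hfin).trans (measureReal_union_le _ _)).trans ?_
  rw [Real.volume_real_Ico, Real.dist_eq]
  gcongr
  exact max_le (le_abs_self _) (abs_nonneg _)

/-- The set on which a job released at `r` of size `p` runs if it takes every moment of `B` until
it is completed. It is uncompleted exactly while `B` has offered less than `p`. -/
lemma measureReal_greedy_lt_iff (B : Set ℝ) {r p t : ℝ} (ht : r ≤ t) :
    volume.real ({x | x ∈ B ∧ r ≤ x ∧ volume.real (B ∩ Set.Ico r x) < p} ∩ Set.Ico r t) < p ↔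
      volume.real (B ∩ Set.Ico r t) < p := by
  have hfin : ∀ (C : Set ℝ) (x : ℝ), volume (C ∩ Set.Ico r x) ≠ ⊤ := fun C x =>
    measure_ne_top_of_subset Set.inter_subset_right (by simp)
  constructor
  · intro hlt
    by_contra! hge
    obtain ⟨q, hq1, hq2⟩ := exists_between hlt
    obtain ⟨x, ⟨hrx, hxt⟩, hx⟩ := intermediate_value_Icc ht
      (continuous_measureReal_inter_Ico B r).continuousOn
      (show q ∈ Set.Icc _ _ from ⟨by simpa using measureReal_nonneg.trans hq1.le, hq2.le.trans hge⟩)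
    simp only at hx
    refine hq1.not_ge (hx ▸ measureReal_mono ?_ (hfin _ _))
    rintro y ⟨hyB, hry, hyx⟩
    refine ⟨⟨hyB, hry, lt_of_le_of_lt ?_ (hx ▸ hq2)⟩, hry, hyx.trans_le hxt⟩
    exact measureReal_mono (Set.inter_subset_inter_right _ (Set.Ico_subset_Ico_right hyx.le))
      (hfin _ _)
  · refine lt_of_le_of_lt (measureReal_mono ?_ (hfin _ _))
    rintro y ⟨hy, hyt⟩
    exact ⟨hy.1, hyt⟩

lemma measurableSet_card_lt (s : Finset ι) (S : Schedule ι m) (hS : ∀ t, S.running t ⊆ s) :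
    MeasurableSet {t | (S.running t).card < m} := by
  classical
  have hmeas : Measurable fun t => ∑ i ∈ s, {t | i ∈ S.running t}.indicator (1 : ℝ → ℕ) t :=
    Finset.measurable_fun_sum s fun i _ => measurable_one.indicator (S.measurable i)
  have heq : (fun t => ∑ i ∈ s, {t | i ∈ S.running t}.indicator (1 : ℝ → ℕ) t)
      = fun t => (S.running t).card := by
    funext t
    simp [Set.indicator_apply, Finset.inter_eq_right.2 (hS t)]
  rw [heq] at hmeas
  exact measurableSet_lt hmeas measurable_const

/-- Jobs can be added to an SJF schedule in order of increasing size: the new job uses the machines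
that the others leave idle and does not disturb them. -/
lemma exists_isSJF_on (J : ι → Job) (m : ℕ) (s : Finset ι) :
    ∃ S : Schedule ι m, (∀ t, S.running t ⊆ s) ∧
      ∀ t, (∀ j ∈ S.running t, Alive J S j t) ∧
        ∀ j ∈ s, Alive J S j t → j ∉ S.running t →
          (S.running t).card = m ∧ ∀ i ∈ S.running t, (J i).size ≤ (J j).size := by
  classical
  induction s using Finset.induction_on_max_value (fun i => (J i).size) with
  | empty => exact ⟨⟨fun _ => ∅, by simp, by simp⟩, by simp, by simp⟩
  | insert a s has hmax ih =>
    obtain ⟨S, hSs, hS⟩ := ih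
    set B : Set ℝ := {t | (S.running t).card < m} with hB
    have hBm : MeasurableSet B := measurableSet_card_lt s S hSs
    set R : Set ℝ := {x | x ∈ B ∧ (J a).release ≤ x ∧
      volume.real (B ∩ Set.Ico (J a).release x) < (J a).size} with hR
    have hRm : MeasurableSet R :=
      hBm.inter (measurableSet_Ici.inter (measurableSet_lt
        (continuous_measureReal_inter_Ico B (J a).release).measurable measurable_const))
    have ha : ∀ t, a ∉ S.running t := fun t h => has (hSs t h)
    let S' : Schedule ι m :=
      { running := fun t => if t ∈ R then insert a (S.running t) else S.running t
        card_le := by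
          intro t
          by_cases ht : t ∈ R
          · simp only [ht, if_true, Finset.card_insert_of_notMem (ha t)]
            exact ht.1
          · simpa only [ht, if_false] using S.card_le t
        measurable := by
          intro j
          by_cases hj : j = a
          · subst hj
            convert hRm using 1
            ext t
            by_cases ht : t ∈ R <;> simp [ht, ha t]
          · convert S.measurable j using 1
            ext t
            by_cases ht : t ∈ R <;> simp [ht, hj] }
    have hpos : ∀ t ∈ R, S'.running t = insert a (S.running t) := fun t ht => by simp [S', ht]
    have hneg : ∀ t ∉ R, S'.running t = S.running t := fun t ht => by simp [S', ht]
    have hmem : ∀ j ≠ a, ∀ t, j ∈ S'.running t ↔ j ∈ S.running t := by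
      intro j hj t
      by_cases ht : t ∈ R
      · simp [hpos t ht, hj]
      · simp [hneg t ht]
    have hmema : ∀ t, a ∈ S'.running t ↔ t ∈ R := by
      intro t
      by_cases ht : t ∈ R
      · simp [hpos t ht, ht]
      · simp [hneg t ht, ht, ha t]
    have halive : ∀ j ≠ a, ∀ t, Alive J S' j t ↔ Alive J S j t := by
      intro j hj t
      simp only [Alive, processed, hmem j hj]
    have halivea : ∀ t, Alive J S' a t ↔ (J a).release ≤ t ∧
        volume.real (B ∩ Set.Ico (J a).release t) < (J a).size := by
      intro t
      simp only [Alive, processed, hmema]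
      exact and_congr_right fun h => measureReal_greedy_lt_iff B h
    refine ⟨S', ?_, fun t => ⟨?_, ?_⟩⟩
    · intro t
      by_cases ht : t ∈ R
      · rw [hpos t ht]; exact Finset.insert_subset_insert a (hSs t)
      · rw [hneg t ht]; exact (hSs t).trans (Finset.subset_insert a s)
    · intro j hj
      by_cases hja : j = a
      · subst hja
        exact (halivea t).2 ((hmema t).1 hj).2
      · exact (halive j hja t).2 ((hS t).1 j ((hmem j hja t).1 hj))
    · intro j hjs hj hjr
      by_cases hja : j = a
      · subst hja
        have htR : t ∉ R := fun h => hjr ((hmema t).2 h)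
        have htB : t ∉ B := fun h => htR ⟨h, (halivea t).1 hj⟩
        rw [hneg t htR]
        exact ⟨le_antisymm (S.card_le t) (not_lt.1 htB), fun i hi => hmax i (hSs t hi)⟩
      · have hjs' : j ∈ s := (Finset.mem_insert.1 hjs).resolve_left hja
        obtain ⟨hc, hle⟩ := (hS t).2 j hjs' ((halive j hja t).1 hj)
          (fun h => hjr ((hmem j hja t).2 h))
        have htR : t ∉ R := fun h => (show (S.running t).card < m from h.1).ne hc
        rw [hneg t htR]
        exact ⟨hc, hle⟩

lemma exists_isSJF [Fintype ι] (J : ι → Job) (m : ℕ) : ∃ S : Schedule ι m, IsSJF J S := by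
  obtain ⟨S, -, hS⟩ := exists_isSJF_on J m Finset.univ
  exact ⟨S, fun t => ⟨(hS t).1, fun j => (hS t).2 j (Finset.mem_univ j)⟩⟩

/-! ### Feasibility -/

lemma exists_feasible_minMachines [Fintype ι] (J : ι → Job) (hJ : ∀ j, 0 ≤ (J j).laxity) :
    ∃ S : Schedule ι (minMachines J), Feasible J S := by
  refine Nat.sInf_mem (s := {m : ℕ | ∃ S : Schedule ι m, Feasible J S})
    ⟨Fintype.card ι, ⟨fun _ => Finset.univ, by simp, by simp⟩, fun j => ?_⟩
  have h1 := hJ j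
  have h2 := (J j).release_lt_deadline
  simp only [Job.laxity] at h1
  simp only [processed, Finset.mem_univ, Set.ofPred_true, Set.univ_inter,
    Real.volume_real_Ico_of_le h2.le]
  linarith

/-- The lifespans of the jobs together with the processing times in a feasible schedule. -/
lemma Feasible.densePacking {J : ι → Job} {S : Schedule ι m} (hS : Feasible J S) {lam : ℝ}
    (hlam : 0 < lam) (hlam2 : lam ≤ 1 / 2) (hJ : ∀ j, (J j).laxity ≤ lam *
      ((J j).deadline - (J j).release)) (hm : 0 < m) :
    DensePacking (fun j => (J j).release) (fun j => (J j).deadline)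
      (fun j => {t | j ∈ S.running t} ∩ Set.Ico (J j).release (J j).deadline) lam m where
  lt j := (J j).release_lt_deadline
  measurable j := (S.measurable j).inter measurableSet_Ico
  subset _ := Set.inter_subset_right
  dense j := by
    have h1 := hS j
    have h2 := hJ j
    simp only [Job.laxity] at h2
    simp only [processed] at h1
    linarith
  card_le t T hT := (Finset.card_le_card fun i hi => (hT i hi).1).trans (S.card_le t)
  lam_pos := hlam
  lam_le := hlam2
  pos := hm

/-- If, within the lifespan of each job, the times at which `m` jobs of at most twice its length are
in their lifespans have measure at most the laxity, then SJF is feasible. For a failing job with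
the earliest deadline, every job running while it waits is still in its own lifespan. -/
lemma IsSJF.feasible [Finite ι] {J : ι → Job} {S : Schedule ι m} (hS : IsSJF J S)
    (hhalf : ∀ j, 2 * (J j).laxity ≤ (J j).deadline - (J j).release)
    (hlax : ∀ j, 0 ≤ (J j).laxity)
    (hdeep : ∀ j, volume.real (Set.Ico (J j).release (J j).deadline ∩
      deepPoints (fun i => (J i).release) (fun i => (J i).deadline)
        (2 * ((J j).deadline - (J j).release)) m) ≤ (J j).laxity) :
    Feasible J S := by
  by_contra hfail
  simp only [Feasible, not_forall, not_le] at hfail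
  obtain ⟨j, hj, hmin⟩ := Set.exists_min_image
    {j | processed J S j (J j).deadline < (J j).size} (fun j => (J j).deadline)
    (Set.toFinite _) hfail
  set I := Set.Ico (J j).release (J j).deadline with hI
  have hsub : I \ {t | j ∈ S.running t} ⊆ I ∩ deepPoints (fun i => (J i).release)
      (fun i => (J i).deadline) (2 * ((J j).deadline - (J j).release)) m := by
    rintro t ⟨htI, htj⟩
    have hal : Alive J S j t := ⟨htI.1, (processed_mono J S j htI.2.le).trans_lt hj⟩
    obtain ⟨hcard, hsize⟩ := (hS t).2 j hal htj
    refine ⟨htI, S.running t, hcard.ge, fun i hi => ?_⟩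
    obtain ⟨hri, hpi⟩ := (hS t).1 i hi
    refine ⟨⟨hri, ?_⟩, ?_⟩
    · by_contra! hdi
      have := hmin i ((processed_mono J S i hdi).trans_lt hpi)
      exact (hdi.trans_lt htI.2).not_ge this
    · have h1 := hhalf i
      have h2 := hlax j
      have h3 := hsize i hi
      simp only [Job.laxity] at h1 h2
      linarith
  have hle := (measureReal_mono hsub
    (measure_ne_top_of_subset Set.inter_subset_left (by simp [hI]))).trans (hdeep j)
  have hsplit := measureReal_sdiff_add_inter (μ := volume) (s := I) (S.measurable j)
    (by simp [hI])
  rw [Set.inter_comm, hI, Real.volume_real_Ico_of_le (J j).release_lt_deadline.le] at hsplit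
  simp only [Set.mem_ofPred_eq, processed] at hj
  simp only [Job.laxity] at hle
  linarith

/-- The number `k` for which the bound `lam₂ ^ k` of the John–Nirenberg inequality drops to the
least relative laxity. -/
lemma exists_pow_le_of_logb {lam₁ lam₂ : ℝ} (h1 : 0 < lam₁) (h12 : lam₁ ≤ lam₂)
    (h2 : lam₂ ≤ 1 / 2) :
    ∃ k : ℕ, lam₂ ^ k ≤ lam₁ ∧
      (k : ℝ) ≤ 3 * max 1 (Real.logb (1 / lam₂) (5 * lam₂ / lam₁)) := by
  have h0 : 0 < lam₂ := h1.trans_le h12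
  have hb : 1 < 1 / lam₂ := by rw [lt_div_iff₀ h0]; linarith
  set x := Real.logb (1 / lam₂) (lam₂ / lam₁) with hx
  have hx0 : 0 ≤ x := Real.logb_nonneg hb (by rwa [le_div_iff₀ h1, one_mul])
  have hxle : x ≤ Real.logb (1 / lam₂) (5 * lam₂ / lam₁) :=
    Real.logb_le_logb_of_le hb (by positivity) (by gcongr; linarith)
  refine ⟨⌈x⌉₊ + 1, ?_, ?_⟩
  · have hpow : lam₂ / lam₁ ≤ (1 / lam₂) ^ ⌈x⌉₊ := by
      calc lam₂ / lam₁ = (1 / lam₂) ^ x := by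
            rw [hx, Real.rpow_logb (by positivity) hb.ne' (by positivity)]
        _ ≤ (1 / lam₂) ^ ((⌈x⌉₊ : ℕ) : ℝ) := Real.rpow_le_rpow_of_exponent_le hb.le (Nat.le_ceil x)
        _ = _ := Real.rpow_natCast _ _
    rw [one_div, inv_pow, div_le_iff₀ h1, inv_mul_eq_div, le_div_iff₀ (by positivity)] at hpow
    rw [pow_succ]
    linarith
  · have := Nat.ceil_lt_add_one hx0
    push_cast
    have h3 := le_max_left 1 (Real.logb (1 / lam₂) (5 * lam₂ / lam₁))
    have h4 := hxle.trans (le_max_right 1 (Real.logb (1 / lam₂) (5 * lam₂ / lam₁)))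
    linarith

end
end Sched

theorem mainTheorem2 :
    ∃ c : ℝ, 0 < c ∧
      ∀ (lam₁ lam₂ : ℝ), 0 < lam₁ → lam₁ ≤ lam₂ → lam₂ ≤ 1 / 2 →
      ∀ (n : ℕ) (J : Fin n → Sched.Job),
        (∀ j, lam₁ ≤ (J j).relLaxity ∧ (J j).relLaxity ≤ lam₂) →
      ∀ m : ℕ,
        c * max 1 (Real.logb (1 / lam₂) (5 * lam₂ / lam₁)) * (Sched.minMachines J : ℝ) ≤ (m : ℝ) →
        (∃ S : Sched.Schedule (Fin n) m, Sched.IsSJF J S) ∧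
          ∀ S : Sched.Schedule (Fin n) m, Sched.IsSJF J S → Sched.Feasible J S := by
  refine ⟨3 * 1535, by norm_num, ?_⟩
  intro lam₁ lam₂ h1 h12 h2 n J hJ m hm
  refine ⟨Sched.exists_isSJF J m, fun S hS => ?_⟩
  have hlen : ∀ j, 0 < (J j).deadline - (J j).release := fun j =>
    sub_pos.2 (J j).release_lt_deadline
  have hlow : ∀ j, lam₁ * ((J j).deadline - (J j).release) ≤ (J j).laxity := fun j =>
    (le_div_iff₀ (hlen j)).1 (hJ j).1
  have hupp : ∀ j, (J j).laxity ≤ lam₂ * ((J j).deadline - (J j).release) := fun j =>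
    (div_le_iff₀ (hlen j)).1 (hJ j).2
  have hlax : ∀ j, 0 ≤ (J j).laxity := fun j => (mul_pos h1 (hlen j)).le.trans (hlow j)
  obtain ⟨O, hO⟩ := Sched.exists_feasible_minMachines J hlax
  obtain ⟨k, hk, hkc⟩ := Sched.exists_pow_le_of_logb h1 h12 h2
  -- Without machines no job can be completed, so that there are no jobs.
  rcases Nat.eq_zero_or_pos (Sched.minMachines J) with hM | hM
  · intro j
    have hrun : ∀ t, O.running t = ∅ := fun t =>
      Finset.card_eq_zero.1 (Nat.le_zero.1 ((O.card_le t).trans hM.le))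
    have := hO j
    simp only [Sched.processed, hrun, Finset.notMem_empty, Set.ofPred_false, Set.empty_inter,
      measureReal_empty] at this
    exact absurd (J j).size_pos this.not_gt
  have hkm : k * (1535 * Sched.minMachines J) ≤ m := by
    have : (k : ℝ) * (1535 * (Sched.minMachines J : ℝ)) ≤ m := by
      refine le_trans ?_ hm
      calc (k : ℝ) * (1535 * (Sched.minMachines J : ℝ))
          ≤ 3 * max 1 (Real.logb (1 / lam₂) (5 * lam₂ / lam₁)) *
            (1535 * (Sched.minMachines J : ℝ)) := by gcongr
        _ = _ := by ring
    exact_mod_cast this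
  have hpack := hO.densePacking (h1.trans_le h12) h2 hupp hM
  refine hS.feasible (fun j => ?_) hlax fun j => ?_
  · have := hupp j
    have := hlen j
    nlinarith
  · refine (measureReal_mono (Set.inter_subset_inter_right _ ?_)
      (measure_ne_top_of_subset Set.inter_subset_left (by simp))).trans
      ((hpack.measureReal_deepPoints_le k (J j).release_lt_deadline le_rfl).trans ?_)
    · rintro t ⟨T, hT, hT'⟩
      exact ⟨T, hkm.trans hT, hT'⟩
    · exact (mul_le_mul_of_nonneg_right hk (hlen j).le).trans (hlow j)
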